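/- Theorem B. A metric measure space is a complete separable metric space $(X,d_X)$ with a Borel probability measure $\mu_X$. Two of them, $X$ and $Y$, are mm-isomorphic if there is an isometry $f$ of $\operatorname{supp}\mu_X$ onto $\operatorname{supp}\mu_Y$ with $f_*\mu_X=\mu_Y$. Let $\mathcal X$ be the space of mm-isomorphism classes of metric measure spaces, with the topology of the box distance $\square$: $\square(X,Y)$ is the infimum of all $\varepsilon\ge 0$ for which there are Borel maps $\varphi:[0,1]\to X$ and $\psi:[0,1]\to Y$, pushing the Lebesgue measure $\mathcal L$ forward to $\mu_X$ and $\mu_Y$, and a Borel set $I_0\subseteq[0,1]$ with $\mathcal L(I_0)\ge 1-\varepsilon$, such that $|d_X(\varphi(s),\varphi(t))-d_Y(\psi(s),\psi(t))|\le\varepsilon$ for all $s,t\in I_0$. For $t=(t_i)_{i\ge 1}\in[0,1]^{\mathbb N}$ let $$C_t=\{(0,0)\}\cup\bigcup_{i\ge 1}\bigl(\{2^{-i+2}\}\times[0,2^{-i}(1+t_i)]\bigr)\subset\mathbb R^2$$ with the metric $d_t$ induced by the $\ell_1$-metric, and let $\mu_t$ be the Borel probability measure on $C_t$ that on the $i$-th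 tooth $\{2^{-i+2}\}\times[0,2^{-i}(1+t_i)]$ is the one-dimensional Lebesgue measure divided by $1+t_i$ (so that this tooth has mass $2^{-i}$), for every $i\ge 1$. Then the map $t\mapsto[C_t,d_t,\mu_t]$ is a topological embedding of the Hilbert cube $[0,1]^{\mathbb N}$ into $\mathcal X$. Moreover $\mathcal X$ is strongly infinite-dimensional: it is a normal space, and there is a sequence $(A_i,B_i)_{i\in\mathbb N}$ of pairs of disjoint closed subsets of $\mathcal X$ such that $\bigcap_i L_i\neq\emptyset$ whenever each $L_i$ is a partition between $A_i$ and $B_i$, that is, whenever $\mathcal X\setminus L_i=U_i\cup V_i$ with disjoint open sets $U_i\supseteq A_i$ and $V_i\supseteq B_i$. -/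

import Mathlib

open MeasureTheory Set

/-- A metric measure space: a complete separable metric space with a Borel probability measure.
Every separable metric space has at most continuum many points, so that spaces with a carrier
in `Type` represent all of them up to isomorphism. -/
structure MMSpace where
  /-- the underlying set -/
  carrier : Type
  [metric : MetricSpace carrier]
  [complete : CompleteSpace carrier]
  [separable : TopologicalSpace.SeparableSpace carrier]
  [meas : MeasurableSpace carrier]
  [borel : BorelSpace carrier]
  /-- the measure -/
  μ : Measure carrier
  [prob : IsProbabilityMeasure μ]

namespace MMSpace

instance : CoeSort MMSpace Type := ⟨MMSpace.carrier⟩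

instance (X : MMSpace) : MetricSpace X := X.metric
instance (X : MMSpace) : CompleteSpace X := X.complete
instance (X : MMSpace) : TopologicalSpace.SeparableSpace X := X.separable
instance (X : MMSpace) : MeasurableSpace X := X.meas
instance (X : MMSpace) : BorelSpace X := X.borel
instance (X : MMSpace) : IsProbabilityMeasure X.μ := X.prob
instance (X : MMSpace) : SecondCountableTopology X :=
  UniformSpace.secondCountable_of_separable X
instance (X : MMSpace) : Nonempty X := nonempty_of_isProbabilityMeasure X.μ

/-- Two metric measure spaces are mm-isomorphic if there is an isometry between the supports of
their measures that carries the one measure to the other. -/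
def MMIso (X Y : MMSpace) : Prop :=
  ∃ f : X.μ.support ≃ᵢ Y.μ.support,
    (X.μ.comap (Subtype.val : X.μ.support → X)).map f =
      Y.μ.comap (Subtype.val : Y.μ.support → Y)

theorem mmIso_equivalence : Equivalence MMIso where
  refl X := ⟨IsometryEquiv.refl _, by
    exact Measure.map_id⟩
  symm := by
    rintro X Y ⟨f, hf⟩
    refine ⟨f.symm, ?_⟩
    have h1 := f.continuous.measurable
    have h2 := f.symm.continuous.measurable
    rw [← hf, Measure.map_map h2 h1]
    have : (f.symm ∘ f) = id := by ext x; simp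
    rw [this, Measure.map_id]
  trans := by
    rintro X Y Z ⟨f, hf⟩ ⟨g, hg⟩
    refine ⟨f.trans g, ?_⟩
    have h1 := f.continuous.measurable
    have h2 := g.continuous.measurable
    rw [← hg, ← hf, Measure.map_map h2 h1]
    rfl

instance : Setoid MMSpace := ⟨MMIso, mmIso_equivalence⟩

/-- A parameter of `X`: a Borel map from the unit interval to `X` that pushes the Lebesgue measure
forward to the measure of `X`. -/
def IsParameter (X : MMSpace) (φ : unitInterval → X) : Prop :=
  Measurable φ ∧ (volume : Measure unitInterval).map φ = X.μ

/-- `ε` is admissible for `X` and `Y` if there are parameters `φ` of `X` and `ψ` of `Y` whose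
pulled back distances differ by at most `ε` on a Borel set of Lebesgue measure at least `1 - ε`. -/
def BoxAdmissible (X Y : MMSpace) (ε : ℝ) : Prop :=
  0 ≤ ε ∧ ∃ (φ : unitInterval → X) (ψ : unitInterval → Y),
    IsParameter X φ ∧ IsParameter Y ψ ∧
      ∃ I₀ : Set unitInterval, MeasurableSet I₀ ∧
        (∀ s ∈ I₀, ∀ t ∈ I₀, |dist (φ s) (φ t) - dist (ψ s) (ψ t)| ≤ ε) ∧
        1 - ε ≤ (volume : Measure unitInterval).real I₀

/-- The box distance between two metric measure spaces. -/
noncomputable def boxDist (X Y : MMSpace) : ℝ := sInf {ε : ℝ | BoxAdmissible X Y ε}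

theorem exists_isParameter (X : MMSpace) : ∃ φ : unitInterval → X, IsParameter X φ :=
  Measure.exists_measurable_map_eq X.μ

theorem boxAdmissible_one (X Y : MMSpace) : BoxAdmissible X Y 1 := by
  obtain ⟨φ, hφ⟩ := exists_isParameter X
  obtain ⟨ψ, hψ⟩ := exists_isParameter Y
  exact ⟨zero_le_one, φ, ψ, hφ, hψ, ∅, MeasurableSet.empty, by simp, by simp⟩

theorem bddBelow_boxAdmissible (X Y : MMSpace) : BddBelow {ε : ℝ | BoxAdmissible X Y ε} :=
  ⟨0, fun _ h => h.1⟩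

theorem boxDist_nonneg (X Y : MMSpace) : 0 ≤ boxDist X Y := Real.sInf_nonneg fun _ h => h.1

theorem boxDist_le {X Y : MMSpace} {ε : ℝ} (h : BoxAdmissible X Y ε) : boxDist X Y ≤ ε :=
  csInf_le (bddBelow_boxAdmissible X Y) h

theorem BoxAdmissible.symm {X Y : MMSpace} {ε : ℝ} (h : BoxAdmissible X Y ε) :
    BoxAdmissible Y X ε := by
  obtain ⟨h0, φ, ψ, hφ, hψ, I₀, hI, hd, hm⟩ := h
  exact ⟨h0, ψ, φ, hψ, hφ, I₀, hI, fun s hs t ht => by rw [abs_sub_comm]; exact hd s hs t ht, hm⟩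

theorem boxDist_comm (X Y : MMSpace) : boxDist X Y = boxDist Y X :=
  congrArg sInf (Set.ext fun _ => ⟨BoxAdmissible.symm, BoxAdmissible.symm⟩)

/-- Two parameters of the same space can be reparametrized so that they agree almost
everywhere. -/
theorem IsParameter.glue {Y : MMSpace} {ψ₁ ψ₂ : unitInterval → Y} (h₁ : IsParameter Y ψ₁)
    (h₂ : IsParameter Y ψ₂) :
    ∃ a b : unitInterval → unitInterval, MeasurePreserving a ∧ MeasurePreserving b ∧
      ∀ᵐ u, ψ₁ (a u) = ψ₂ (b u) := by
  let κ := ProbabilityTheory.condDistrib id ψ₂ (volume : Measure unitInterval)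
  let η := κ.comap ψ₁ h₁.1
  let γ : Measure (unitInterval × unitInterval) := volume.compProd η
  have hκ : Y.μ.compProd κ = (volume : Measure unitInterval).map fun x => (ψ₂ x, x) := by
    have := ProbabilityTheory.compProd_map_condDistrib (μ := (volume : Measure unitInterval))
      (mβ := Y.meas) (X := ψ₂) (Y := id) aemeasurable_id
    rw [h₂.2] at this
    exact this
  have hY : ∀ᵐ y ∂Y.μ, ∀ᵐ v ∂(κ y), y = ψ₂ v := by
    have hs : MeasurableSet {p : Y × unitInterval | p.1 = ψ₂ p.2} :=
      measurableSet_eq_fun measurable_fst (h₂.1.comp measurable_snd)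
    refine Measure.ae_ae_of_ae_compProd (μ := Y.μ) (κ := κ) (p := fun p => p.1 = ψ₂ p.2) ?_
    have hm : Measurable fun x => (ψ₂ x, x) := h₂.1.prodMk measurable_id
    rw [hκ, ae_map_iff hm.aemeasurable hs]
    simp
  have hγ1 : γ.map Prod.fst = volume := Measure.fst_compProd _ _
  have hγ2 : γ.map Prod.snd = volume := by
    change (volume.compProd η).snd = volume
    rw [Measure.snd_compProd]
    have e : (Y.μ.compProd κ).snd = volume := by
      have hm : Measurable fun x => (ψ₂ x, x) := h₂.1.prodMk measurable_id
      rw [hκ, Measure.snd, Measure.map_map measurable_snd hm]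
      exact Measure.map_id
    rw [Measure.snd_compProd] at e
    conv_rhs => rw [← e, ← h₁.2]
    ext s hs
    rw [Measure.bind_apply hs η.measurable.aemeasurable,
      Measure.bind_apply hs κ.measurable.aemeasurable,
      lintegral_map (κ.measurable_coe hs) h₁.1]
    rfl
  have hγ3 : ∀ᵐ p ∂γ, ψ₁ p.1 = ψ₂ p.2 := by
    have hs : MeasurableSet {p : unitInterval × unitInterval | ψ₁ p.1 = ψ₂ p.2} :=
      measurableSet_eq_fun (h₁.1.comp measurable_fst) (h₂.1.comp measurable_snd)
    rw [Measure.ae_compProd_iff hs]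
    rw [← h₁.2] at hY
    exact ae_of_ae_map h₁.1.aemeasurable hY
  obtain ⟨θ, hθ, hθγ⟩ := Measure.exists_measurable_map_eq γ
  refine ⟨fun u => (θ u).1, fun u => (θ u).2, ⟨hθ.fst, ?_⟩, ⟨hθ.snd, ?_⟩, ?_⟩
  · conv_rhs => rw [← hγ1, ← hθγ, Measure.map_map measurable_fst hθ]
    rfl
  · conv_rhs => rw [← hγ2, ← hθγ, Measure.map_map measurable_snd hθ]
    rfl
  · rw [← hθγ] at hγ3
    exact ae_of_ae_map hθ.aemeasurable hγ3

theorem BoxAdmissible.trans {X Y Z : MMSpace} {ε δ : ℝ} (h : BoxAdmissible X Y ε)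
    (h' : BoxAdmissible Y Z δ) : BoxAdmissible X Z (ε + δ) := by
  obtain ⟨h0, φ, ψ, hφ, hψ, I₀, hI, hd, hm⟩ := h
  obtain ⟨h0', φ', ψ', hφ', hψ', I₀', hI', hd', hm'⟩ := h'
  obtain ⟨a, b, ha, hb, hab⟩ := hψ.glue hφ'
  have hE : MeasurableSet {u | ψ (a u) = φ' (b u)} :=
    measurableSet_eq_fun (hψ.1.comp ha.measurable) (hφ'.1.comp hb.measurable)
  refine ⟨add_nonneg h0 h0', φ ∘ a, ψ' ∘ b, ⟨hφ.1.comp ha.measurable, ?_⟩,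
    ⟨hψ'.1.comp hb.measurable, ?_⟩, (a ⁻¹' I₀ ∩ b ⁻¹' I₀') ∩ {u | ψ (a u) = φ' (b u)},
    ((ha.measurable hI).inter (hb.measurable hI')).inter hE, ?_, ?_⟩
  · rw [← Measure.map_map hφ.1 ha.measurable, ha.map_eq, hφ.2]
  · rw [← Measure.map_map hψ'.1 hb.measurable, hb.map_eq, hψ'.2]
  · rintro s ⟨⟨hs, hs'⟩, hse⟩ t ⟨⟨ht, ht'⟩, hte⟩
    have e1 := hd _ hs _ ht
    have e2 := hd' _ hs' _ ht'
    rw [← show ψ (a s) = φ' (b s) from hse, ← show ψ (a t) = φ' (b t) from hte] at e2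
    exact (abs_sub_le _ _ _).trans (add_le_add e1 e2)
  · have e0 : (volume : Measure unitInterval).real
        ((a ⁻¹' I₀ ∩ b ⁻¹' I₀') ∩ {u | ψ (a u) = φ' (b u)}) =
        (volume : Measure unitInterval).real (a ⁻¹' I₀ ∩ b ⁻¹' I₀') := by
      refine measureReal_congr ?_
      filter_upwards [hab] with u hu
      exact propext ⟨fun h => h.1, fun h => ⟨h, hu⟩⟩
    have e1 : (volume : Measure unitInterval).real (a ⁻¹' I₀) = volume.real I₀ := by
      simp only [Measure.real, ha.measure_preimage hI.nullMeasurableSet]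
    have e2 : (volume : Measure unitInterval).real (b ⁻¹' I₀') = volume.real I₀' := by
      simp only [Measure.real, hb.measure_preimage hI'.nullMeasurableSet]
    have e3 := measureReal_union_add_inter (μ := (volume : Measure unitInterval))
      (s := a ⁻¹' I₀) (hb.measurable hI')
    have e4 : (volume : Measure unitInterval).real (a ⁻¹' I₀ ∪ b ⁻¹' I₀') ≤ 1 :=
      measureReal_le_one
    rw [e0]
    linarith

theorem boxDist_triangle (X Y Z : MMSpace) : boxDist X Z ≤ boxDist X Y + boxDist Y Z := by
  refine le_of_forall_pos_le_add fun δ hδ => ?_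
  obtain ⟨a, ha, ha'⟩ := exists_lt_of_csInf_lt (s := {ε : ℝ | BoxAdmissible X Y ε})
    ⟨1, boxAdmissible_one X Y⟩ (lt_add_of_pos_right (boxDist X Y) (half_pos hδ))
  obtain ⟨b, hb, hb'⟩ := exists_lt_of_csInf_lt (s := {ε : ℝ | BoxAdmissible Y Z ε})
    ⟨1, boxAdmissible_one Y Z⟩ (lt_add_of_pos_right (boxDist Y Z) (half_pos hδ))
  have := boxDist_le (BoxAdmissible.trans ha hb)
  linarith

theorem MMIso.boxDist_eq_zero {X Y : MMSpace} (h : MMIso X Y) : boxDist X Y = 0 := by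
  classical
  obtain ⟨f, hf⟩ := h
  obtain ⟨φ, hφ⟩ := exists_isParameter X
  have hSX : MeasurableSet X.μ.support := Measure.isClosed_support.measurableSet
  have hSY : MeasurableSet Y.μ.support := Measure.isClosed_support.measurableSet
  have hae : ∀ᵐ u, φ u ∈ X.μ.support :=
    ae_of_ae_map hφ.1.aemeasurable (by rw [hφ.2]; exact Measure.support_mem_ae)
  obtain ⟨y₀⟩ : Nonempty Y := inferInstance
  let g : X → Y := fun x => if hx : x ∈ X.μ.support then (f ⟨x, hx⟩ : Y) else y₀
  have hg : Measurable g :=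
    Measurable.dite (measurable_subtype_coe.comp f.continuous.measurable) measurable_const hSX
  have hgμ : X.μ.map g = Y.μ := by
    have e1 : X.μ = (X.μ.comap (Subtype.val : X.μ.support → X)).map Subtype.val := by
      rw [map_comap_subtype_coe hSX]
      exact (Measure.restrict_eq_self_of_ae_mem Measure.support_mem_ae).symm
    have e2 : (Y.μ.comap (Subtype.val : Y.μ.support → Y)).map Subtype.val = Y.μ := by
      rw [map_comap_subtype_coe hSY]
      exact Measure.restrict_eq_self_of_ae_mem Measure.support_mem_ae
    have e3 : g ∘ (Subtype.val : X.μ.support → X) = Subtype.val ∘ f := by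
      ext x
      simp [g]
    conv_lhs => rw [e1]
    rw [Measure.map_map hg measurable_subtype_coe, e3,
      ← Measure.map_map measurable_subtype_coe f.continuous.measurable, hf, e2]
  refine le_antisymm (boxDist_le ⟨le_rfl, φ, g ∘ φ, hφ, ⟨hg.comp hφ.1, ?_⟩,
    φ ⁻¹' X.μ.support, hφ.1 hSX, ?_, ?_⟩) (boxDist_nonneg X Y)
  · rw [← Measure.map_map hg hφ.1, hφ.2, hgμ]
  · intro s hs t ht
    have hs' : φ s ∈ X.μ.support := hs
    have ht' : φ t ∈ X.μ.support := ht
    have : dist (g (φ s)) (g (φ t)) = dist (φ s) (φ t) := by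
      simp only [g, hs', ht', dite_true]
      rw [← Subtype.dist_eq, f.dist_eq, Subtype.dist_eq]
    simp [this]
  · have : (volume : Measure unitInterval).real (φ ⁻¹' X.μ.support) = 1 := by
      rw [Measure.real, prob_compl_eq_zero_iff (hφ.1 hSX) |>.1 hae, ENNReal.toReal_one]
    rw [this]; norm_num

theorem boxDist_congr {X X' Y Y' : MMSpace} (hX : MMIso X X') (hY : MMIso Y Y') :
    boxDist X Y = boxDist X' Y' := by
  have h1 := hX.boxDist_eq_zero
  have h2 := hY.boxDist_eq_zero
  have h1' := boxDist_comm X X'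
  have h2' := boxDist_comm Y Y'
  have := boxDist_triangle X X' Y
  have := boxDist_triangle X' Y' Y
  have := boxDist_triangle X' X Y'
  have := boxDist_triangle X Y Y'
  linarith

end MMSpace

/-- The set of mm-isomorphism classes of metric measure spaces. -/
def MMClass : Type 1 := Quotient (inferInstance : Setoid MMSpace)

namespace MMClass

/-- The mm-isomorphism class of a metric measure space. -/
def mk (X : MMSpace) : MMClass := Quotient.mk _ X

/-- The space of mm-isomorphism classes carries the box distance (and its topology). The box
distance is a metric; the laws that fix the topology are checked here. -/
noncomputable instance : PseudoMetricSpace MMClass where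
  dist := Quotient.lift₂ MMSpace.boxDist fun _ _ _ _ hX hY => MMSpace.boxDist_congr hX hY
  dist_self := by
    rintro ⟨X⟩
    exact (MMSpace.mmIso_equivalence.refl X).boxDist_eq_zero
  dist_comm := by
    rintro ⟨X⟩ ⟨Y⟩
    exact MMSpace.boxDist_comm X Y
  dist_triangle := by
    rintro ⟨X⟩ ⟨Y⟩ ⟨Z⟩
    exact MMSpace.boxDist_triangle X Y Z

theorem dist_mk (X Y : MMSpace) : dist (mk X) (mk Y) = MMSpace.boxDist X Y := rfl

end MMClass

namespace Comb

/-- The plane with the `ℓ¹` metric. -/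
abbrev Plane : Type := WithLp 1 (ℝ × ℝ)

/-- The length `2⁻ⁱ (1 + t i)` of the `i`-th tooth. The teeth are numbered from `i = 1`
on, and the index `n : ℕ` stands for `i = n + 1`. -/
noncomputable def len (t : ℕ → unitInterval) (n : ℕ) : ℝ := (1 / 2) ^ (n + 1) * (1 + (t n : ℝ))

/-- The point at height `y` above the foot `(2⁻ⁱ⁺², 0)` of the `i`-th tooth, `i = n + 1`. -/
noncomputable def pt (n : ℕ) (y : ℝ) : Plane := WithLp.toLp 1 (2 * (1 / 2) ^ n, y)

/-- The comb: the origin with the teeth `{2⁻ⁱ⁺²} × [0, 2⁻ⁱ (1 + t i)]`. -/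
def set (t : ℕ → unitInterval) : Set Plane :=
  {WithLp.toLp 1 (0, 0)} ∪ ⋃ n : ℕ, pt n '' Icc 0 (len t n)

/-- The measure of the comb, as a measure on the plane: on the `i`-th tooth it is the Lebesgue
measure divided by `1 + t i`. -/
noncomputable def planeMeasure (t : ℕ → unitInterval) : Measure Plane :=
  Measure.sum fun n : ℕ =>
    ENNReal.ofReal (1 + (t n : ℝ))⁻¹ • (volume.restrict (Icc 0 (len t n))).map (pt n)

/-- The measure of the comb, as a measure on the comb. -/
noncomputable def measure (t : ℕ → unitInterval) : Measure (set t) :=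
  (planeMeasure t).comap Subtype.val

theorem continuous_pt (n : ℕ) : Continuous (pt n) :=
  (WithLp.prod_continuous_toLp 1 ℝ ℝ).comp (by fun_prop)

theorem len_nonneg (t : ℕ → unitInterval) (n : ℕ) : 0 ≤ len t n :=
  mul_nonneg (by positivity) (add_nonneg zero_le_one (t n).2.1)

theorem isClosed_tooth (t : ℕ → unitInterval) (n : ℕ) : IsClosed (pt n '' Icc 0 (len t n)) :=
  (isCompact_Icc.image (continuous_pt n)).isClosed

theorem isClosed_set (t : ℕ → unitInterval) : IsClosed (set t) := by
  have hfst : Continuous fun q : Plane => q.fst :=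
    continuous_fst.comp (WithLp.prod_continuous_ofLp 1 ℝ ℝ)
  have hsnd : Continuous fun q : Plane => q.snd :=
    continuous_snd.comp (WithLp.prod_continuous_ofLp 1 ℝ ℝ)
  have hsub : set t ⊆ {q : Plane | 0 ≤ q.snd ∧ q.snd ≤ q.fst} := by
    rintro q (rfl | hq)
    · simp
    · obtain ⟨n, y, ⟨hy0, hy⟩, rfl⟩ := mem_iUnion.1 hq
      refine ⟨hy0, hy.trans (show len t n ≤ 2 * (1 / 2) ^ n from ?_)⟩
      have h1 : (t n : ℝ) ≤ 1 := (t n).2.2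
      have h2 : (0 : ℝ) < (1 / 2) ^ n := by positivity
      simp only [len, pow_succ]
      nlinarith
  have hcl : IsClosed {q : Plane | 0 ≤ q.snd ∧ q.snd ≤ q.fst} :=
    (isClosed_le continuous_const hsnd).inter (isClosed_le hsnd hfst)
  refine isClosed_of_closure_subset fun p hp => ?_
  obtain ⟨hp0, hp1⟩ := closure_minimal hsub hcl hp
  rcases (hp0.trans hp1).eq_or_lt with h0 | h0
  · left
    have : p.snd = 0 := le_antisymm (hp1.trans h0.symm.le) hp0
    exact (WithLp.ofLp_injective 1) (Prod.ext h0.symm this)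
  · obtain ⟨N, hN⟩ := exists_pow_lt_of_lt_one (half_pos h0) (by norm_num : (1 / 2 : ℝ) < 1)
    have hF : IsClosed (⋃ n ∈ Finset.range N, pt n '' Icc 0 (len t n)) :=
      isClosed_biUnion_finset fun n _ => isClosed_tooth t n
    have hU : IsOpen {q : Plane | 2 * (1 / 2) ^ N < q.fst} := isOpen_lt continuous_const hfst
    have hpU : p ∈ {q : Plane | 2 * (1 / 2) ^ N < q.fst} := by
      change 2 * (1 / 2) ^ N < p.fst
      linarith
    have hsub' : {q : Plane | 2 * (1 / 2) ^ N < q.fst} ∩ set t ⊆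
        ⋃ n ∈ Finset.range N, pt n '' Icc 0 (len t n) := by
      rintro q ⟨hqU, rfl | hq⟩
      · have h2 : (0 : ℝ) < (1 / 2) ^ N := by positivity
        have hqU' : 2 * (1 / 2) ^ N < (0 : ℝ) := hqU
        linarith
      · obtain ⟨n, y, hy, rfl⟩ := mem_iUnion.1 hq
        have hn : n < N := by
          by_contra! hn
          have := pow_le_pow_of_le_one (by norm_num : (0 : ℝ) ≤ 1 / 2) (by norm_num) hn
          have hqU' : 2 * (1 / 2) ^ N < 2 * (1 / 2 : ℝ) ^ n := hqU
          linarith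
        exact mem_biUnion (Finset.mem_coe.2 (Finset.mem_range.2 hn)) ⟨y, hy, rfl⟩
    have := closure_minimal hsub' hF (hU.inter_closure ⟨hpU, hp⟩)
    obtain ⟨n, _, hn⟩ := mem_iUnion₂.1 this
    exact Or.inr (mem_iUnion.2 ⟨n, hn⟩)

theorem planeMeasure_univ (t : ℕ → unitInterval) : planeMeasure t univ = 1 := by
  have key : ∀ n : ℕ, (ENNReal.ofReal (1 + (t n : ℝ))⁻¹ •
      (volume.restrict (Icc 0 (len t n))).map (pt n)) univ = 2⁻¹ ^ (n + 1) := by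
    intro n
    have hpos : (0 : ℝ) < 1 + t n := by linarith [(t n).2.1]
    rw [Measure.smul_apply, Measure.map_apply (continuous_pt n).measurable MeasurableSet.univ,
      preimage_univ, Measure.restrict_apply_univ, Real.volume_Icc, sub_zero, smul_eq_mul,
      ← ENNReal.ofReal_mul (by positivity), len,
      show (1 + (t n : ℝ))⁻¹ * ((1 / 2) ^ (n + 1) * (1 + (t n : ℝ))) = (2⁻¹) ^ (n + 1) by
        field_simp,
      ENNReal.ofReal_pow (by positivity), ENNReal.ofReal_inv_of_pos (by norm_num)]
    norm_num
  rw [planeMeasure, Measure.sum_apply _ MeasurableSet.univ]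
  simp_rw [key]
  rw [ENNReal.tsum_geometric_add_one, ENNReal.one_sub_inv_two, inv_inv]
  exact ENNReal.inv_mul_cancel (by norm_num) (by norm_num)

theorem planeMeasure_compl (t : ℕ → unitInterval) : planeMeasure t (set t)ᶜ = 0 := by
  have hm := (isClosed_set t).measurableSet.compl
  rw [planeMeasure, Measure.sum_apply _ hm, ENNReal.tsum_eq_zero]
  intro n
  rw [Measure.smul_apply, Measure.map_apply (continuous_pt n).measurable hm,
    Measure.restrict_apply ((continuous_pt n).measurable hm)]
  have : pt n ⁻¹' (set t)ᶜ ∩ Icc 0 (len t n) = ∅ := by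
    ext y
    simp only [mem_inter_iff, mem_preimage, mem_compl_iff, mem_empty_iff_false, iff_false, not_and]
    exact fun h hy => h (Or.inr (mem_iUnion.2 ⟨n, y, hy, rfl⟩))
  rw [this, measure_empty, smul_zero]

instance (t : ℕ → unitInterval) : IsProbabilityMeasure (measure t) := by
  constructor
  have hm := (isClosed_set t).measurableSet
  rw [measure, comap_subtype_coe_apply hm, image_univ, Subtype.range_coe]
  exact (measure_of_measure_compl_eq_zero (planeMeasure_compl t)).trans (planeMeasure_univ t)

/-- The comb as a metric measure space, with the metric of the plane. -/
noncomputable def space (t : ℕ → unitInterval) : MMSpace :=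
  haveI : CompleteSpace (set t) := (isClosed_set t).completeSpace_coe
  { carrier := set t
    μ := measure t }

end Comb

section Dimension

variable {X : Type*} [TopologicalSpace X]

/-- `L` is a partition between `A` and `B`: its complement is the union of two disjoint open sets,
one of which contains `A` and the other one `B`. -/
def IsPartitionBetween (L A B : Set X) : Prop :=
  ∃ U V : Set X, IsOpen U ∧ IsOpen V ∧ A ⊆ U ∧ B ⊆ V ∧ Disjoint U V ∧ Lᶜ = U ∪ V

variable (X) in
/-- A normal space is strongly infinite-dimensional if it has an infinite sequence of pairs of
disjoint closed sets such that any choice of partitions between them has a common point. -/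
def StronglyInfiniteDimensional : Prop :=
  NormalSpace X ∧ ∃ A B : ℕ → Set X,
    (∀ i, IsClosed (A i) ∧ IsClosed (B i) ∧ Disjoint (A i) (B i)) ∧
      ∀ L : ℕ → Set X, (∀ i, IsPartitionBetween (L i) (A i) (B i)) → (⋂ i, L i).Nonempty

end Dimension

/-! The map from the cube is continuous because all combs share one parameter space, `source`:
scaling its intervals tooth by tooth gives a coupling of two combs that moves points of the `n`-th
tooth by at most `2⁻⁽ⁿ⁺¹⁾ |t n - s n|` (`boxDist_space_le`).

It is injective even modulo box distance zero. At box distance zero, finite subsets of one comb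
embed isometrically into the other (`exists_dist_eq_of_boxDist_eq_zero`). The diameter of a comb
gives the length of its first tooth and singles out the origin. Distances from the origin fall into
disjoint ranges for different teeth, so each length can be read off (`len_le_of_boxDist_eq_zero`).
Compactness of the cube then makes the map a closed embedding into the separation quotient.

Strong infinite-dimensionality comes from the cube, whose opposite faces form an essential family
(`nonempty_iInter_of_isPartitionBetween_faces`); partitions of the class space pull back to the
cube. In dimension `n` essentiality is a parity count on the Kuhn triangulation: colour the vertices
by `f i = 0` on `U i` and `1` elsewhere, and sum the cup product of the coboundaries of the `f i`
over all simplices. The sum is 1 modulo 2 (`sum_cupCoboundary_eq_one`), because replacing one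
colouring by another with the same values on the two faces changes it by a coboundary. Hence some
simplex meets both colours in every coordinate; refining the grid and passing to a limit yields a
point in all partitions. -/

/-! ### Cup products of coboundaries modulo 2 -/

/-- The cup product of the coboundaries of `f 0, …, f (n - 1)` modulo 2 on the simplex with
vertices `v 0, …, v n`. -/
def cupCoboundary {V : Type*} (n : ℕ) (f : ℕ → V → ZMod 2) (v : ℕ → V) : ZMod 2 :=
  ∏ i ∈ Finset.range n, (f i (v (i + 1)) + f i (v i))

/-- The sequence `v` with the `j`-th entry left out. -/
def skipAt {V : Type*} (j : ℕ) (v : ℕ → V) (i : ℕ) : V := if i < j then v i else v (i + 1)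

theorem cupCoboundary_congr {V : Type*} {n : ℕ} (f : ℕ → V → ZMod 2) {v w : ℕ → V}
    (h : ∀ i ≤ n, v i = w i) : cupCoboundary n f v = cupCoboundary n f w := by
  refine Finset.prod_congr rfl fun i hi => ?_
  have := Finset.mem_range.1 hi
  rw [h i (by omega), h (i + 1) (by omega)]

theorem cupCoboundary_succ {V : Type*} (n : ℕ) (f : ℕ → V → ZMod 2) (v : ℕ → V) :
    cupCoboundary (n + 1) f v = cupCoboundary n f v * (f n (v (n + 1)) + f n (v n)) :=
  Finset.prod_range_succ _ _

theorem cupCoboundary_skipAt_of_lt {V : Type*} {n j : ℕ} (h : n < j) (f : ℕ → V → ZMod 2)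
    (v : ℕ → V) : cupCoboundary n f (skipAt j v) = cupCoboundary n f v :=
  cupCoboundary_congr f fun i hi => if_pos (by omega)

/-- The cup product of coboundaries is a cocycle. -/
theorem sum_cupCoboundary_skipAt {V : Type*} (n : ℕ) (f : ℕ → V → ZMod 2) (v : ℕ → V) :
    ∑ j ∈ Finset.range (n + 1), cupCoboundary n f (skipAt j v) = cupCoboundary n f v := by
  -- The face without vertex `n + 1` has the vertices `v 0, …, v n`, so its term is the right-hand
  -- side; the identity says that all faces together sum to zero.
  induction n with
  | zero => simp [cupCoboundary]
  | succ n ih =>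
    have e : ∀ j ∈ Finset.range (n + 1), cupCoboundary (n + 1) f (skipAt j v) =
        cupCoboundary n f (skipAt j v) * (f n (v (n + 2)) + f n (v (n + 1))) := by
      intro j hj
      have := Finset.mem_range.1 hj
      rw [cupCoboundary_succ, skipAt, skipAt, if_neg (by omega), if_neg (by omega)]
    rw [Finset.sum_range_succ, Finset.sum_congr rfl e, ← Finset.sum_mul, ih, cupCoboundary_succ,
      cupCoboundary_succ, cupCoboundary_skipAt_of_lt (by omega), skipAt, skipAt,
      if_neg (by omega), if_pos (by omega)]
    have := CharTwo.add_self_eq_zero (f n (v (n + 2)))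
    linear_combination (cupCoboundary n f v) * this

/-- The Leibniz rule for the cup product with a function in the last place. -/
theorem sum_cupCoboundary_mul_skipAt {V : Type*} (n : ℕ) (f : ℕ → V → ZMod 2) (g : V → ZMod 2)
    (v : ℕ → V) :
    ∑ j ∈ Finset.range (n + 2), cupCoboundary n f (skipAt j v) * g (skipAt j v n) =
      cupCoboundary n f v * (g (v (n + 1)) + g (v n)) := by
  -- Only the face that omits the vertex `n + 1` does not end in that vertex; over the other faces
  -- `g` factors out and the cocycle identity applies.
  have e : ∀ j ∈ Finset.range (n + 1), cupCoboundary n f (skipAt j v) * g (skipAt j v n) =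
      cupCoboundary n f (skipAt j v) * g (v (n + 1)) := by
    intro j hj
    have := Finset.mem_range.1 hj
    rw [show skipAt j v n = v (n + 1) from if_neg (by omega)]
  rw [Finset.sum_range_succ, Finset.sum_congr rfl e, ← Finset.sum_mul, sum_cupCoboundary_skipAt,
    cupCoboundary_skipAt_of_lt (by omega), show skipAt (n + 1) v n = v n from if_pos (by omega)]
  ring

/-! ### The parity count on the Kuhn triangulation -/

/-- The `i`-th vertex of the Kuhn simplex with first vertex `p.1` in which the coordinate `l` is
increased in the step from the vertex `p.2 l` to the next one. -/
def kuhnVertex (p : (ℕ → ℤ) × Equiv.Perm ℕ) (i : ℕ) : ℕ → ℤ :=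
  fun l => p.1 l + if p.2 l < i then 1 else 0

/-- The Kuhn simplices of the cube `[0, k] ^ n`. -/
def kuhnSimplices (n k : ℕ) : Set ((ℕ → ℤ) × Equiv.Perm ℕ) :=
  {p | (∀ l, n ≤ l → p.1 l = 0 ∧ p.2 l = l) ∧ ∀ l < n, 0 ≤ p.1 l ∧ p.1 l < k}

theorem perm_apply_lt {σ : Equiv.Perm ℕ} {n : ℕ} (h : ∀ l, n ≤ l → σ l = l) {l : ℕ} (hl : l < n) :
    σ l < n := by
  by_contra! hc
  have := σ.injective (h _ hc)
  omega

theorem finite_kuhnSimplices (n k : ℕ) : (kuhnSimplices n k).Finite := by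
  let F : (ℕ → ℤ) × Equiv.Perm ℕ → (Fin n → ℤ) × (Fin n → ℕ) := fun p =>
    (fun l => p.1 l, fun l => p.2 l)
  have hfin : ((Set.univ.pi fun _ : Fin n => Set.Ico (0 : ℤ) k) ×ˢ
      (Set.univ.pi fun _ : Fin n => Set.Iio n)).Finite :=
    (Set.Finite.pi fun _ => Set.finite_Ico _ _).prod (Set.Finite.pi fun _ => Set.finite_Iio _)
  refine Set.Finite.of_injOn (f := F) ?_ ?_ hfin
  · rintro ⟨x, σ⟩ ⟨h1, h2⟩
    exact ⟨fun l _ => h2 l l.2, fun l _ => perm_apply_lt (fun l hl => (h1 l hl).2) l.2⟩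
  · rintro ⟨x, σ⟩ ⟨h1, h2⟩ ⟨y, τ⟩ ⟨h3, h4⟩ h
    have hx := congrArg Prod.fst h
    have hσ := congrArg Prod.snd h
    refine Prod.ext (funext fun l => ?_) (Equiv.ext fun l => ?_)
    · rcases lt_or_ge l n with hl | hl
      · exact congrFun hx ⟨l, hl⟩
      · exact (h1 l hl).1.trans (h3 l hl).1.symm
    · rcases lt_or_ge l n with hl | hl
      · exact congrFun hσ ⟨l, hl⟩
      · exact (h1 l hl).2.trans (h3 l hl).2.symm

/-- The cyclic permutation of `0, …, n`. -/
def cyclePerm (n : ℕ) : Equiv.Perm ℕ where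
  toFun i := if i < n then i + 1 else if i = n then 0 else i
  invFun i := if i = 0 then n else if i ≤ n then i - 1 else i
  left_inv i := by grind
  right_inv i := by grind

theorem cyclePerm_symm_apply (n i : ℕ) :
    (cyclePerm n).symm i = if i = 0 then n else if i ≤ n then i - 1 else i := rfl

theorem cyclePerm_apply (n i : ℕ) :
    cyclePerm n i = if i < n then i + 1 else if i = n then 0 else i := rfl

section
variable {n k : ℕ} {f : ℕ → (ℕ → ℤ) → ZMod 2}

/-- A cup product that vanishes near the boundary is supported by the simplices of the cube. -/
theorem mem_kuhnSimplices_of_ne_zero {g : (ℕ → ℤ) → ZMod 2}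
    (h0 : ∀ i < n, ∀ v, v i ≤ 0 → f i v = 0) (h1 : ∀ i < n, ∀ v, (k : ℤ) ≤ v i → f i v = 1)
    (g0 : ∀ v, v n ≤ 0 → g v = 0) (g1 : ∀ v, (k : ℤ) ≤ v n → g v = 0)
    {p : (ℕ → ℤ) × Equiv.Perm ℕ} (hp : ∀ l, n + 1 ≤ l → p.1 l = 0 ∧ p.2 l = l) {u : ℕ → ℕ → ℤ}
    (hu : ∀ i l, u i l = p.1 l ∨ u i l = p.1 l + 1) (hne : cupCoboundary n f u * g (u n) ≠ 0) :
    p ∈ kuhnSimplices (n + 1) k := by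
  refine ⟨hp, fun l hl => ?_⟩
  by_contra! hc
  refine hne ?_
  -- A simplex outside the slab `0 ≤ v l ≤ k` lies wholly on one side of it, where `f l` is
  -- constant, or `g` is zero if `l = n`.
  have hcase : (∀ i, u i l ≤ 0) ∨ ∀ i, (k : ℤ) ≤ u i l := by
    by_cases h : 0 ≤ p.1 l
    · have := hc h
      exact Or.inr fun i => by rcases hu i l with h | h <;> omega
    · exact Or.inl fun i => by rcases hu i l with h | h <;> omega
  rcases Nat.lt_succ_iff_lt_or_eq.1 hl with hl | rfl
  · have : cupCoboundary n f u = 0 := by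
      refine Finset.prod_eq_zero (Finset.mem_range.2 hl) ?_
      rcases hcase with h | h
      · rw [h0 l hl _ (h _), h0 l hl _ (h _), add_zero]
      · rw [h1 l hl _ (h _), h1 l hl _ (h _)]; rfl
    rw [this, zero_mul]
  · rcases hcase with h | h
    · rw [g0 _ (h _), mul_zero]
    · rw [g1 _ (h _), mul_zero]

theorem skipAt_kuhnVertex_apply (p : (ℕ → ℤ) × Equiv.Perm ℕ) (j i l : ℕ) :
    skipAt j (kuhnVertex p) i l =
      p.1 l + if p.2 l < (if i < j then i else i + 1) then 1 else 0 := by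
  unfold skipAt
  by_cases h : i < j
  · rw [if_pos h, if_pos h]; rfl
  · rw [if_neg h, if_neg h]; rfl

theorem skipAt_kuhnVertex (p : (ℕ → ℤ) × Equiv.Perm ℕ) (j i l : ℕ) :
    skipAt j (kuhnVertex p) i l = p.1 l ∨ skipAt j (kuhnVertex p) i l = p.1 l + 1 := by
  rw [skipAt_kuhnVertex_apply]
  generalize (if i < j then i else i + 1) = m
  split_ifs <;> simp

/-- Vertex `i` depends only on the set of `l` with `σ l < i`, so exchanging the values `j - 1` and
`j` of `σ` moves vertex `j` alone. The simplices pair off with a common face opposite vertex `j`,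
and each pair cancels modulo 2. -/
theorem sum_skipAt_eq_zero_of_pos (h : (ℕ → ℕ → ℤ) → ZMod 2) {j : ℕ} (hj : 0 < j) (hjn : j ≤ n) :
    ∑ p ∈ (finite_kuhnSimplices (n + 1) k).toFinset, h (skipAt j (kuhnVertex p)) = 0 := by
  refine Finset.sum_involution (fun p _ => (p.1, Equiv.swap (j - 1) j * p.2)) ?_ ?_ ?_ ?_
  · rintro ⟨x, σ⟩ -
    have : skipAt j (kuhnVertex (x, Equiv.swap (j - 1) j * σ)) = skipAt j (kuhnVertex (x, σ)) := by
      ext i l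
      simp only [skipAt_kuhnVertex_apply, Equiv.Perm.mul_apply, Equiv.swap_apply_def]
      grind
    rw [this]
    exact CharTwo.add_self_eq_zero _
  · rintro ⟨x, σ⟩ - - he
    have h1 : Equiv.swap (j - 1) j * σ = σ := congrArg Prod.snd he
    have h2 : Equiv.swap (j - 1) j = 1 := by simpa using h1
    rw [Equiv.Perm.one_def, Equiv.swap_eq_refl_iff] at h2
    omega
  · rintro ⟨x, σ⟩ hp
    rw [Set.Finite.mem_toFinset] at hp ⊢
    refine ⟨fun l hl => ⟨(hp.1 l hl).1, ?_⟩, hp.2⟩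
    have := (hp.1 l hl).2
    simp only [Equiv.Perm.mul_apply] at this ⊢
    rw [this, Equiv.swap_apply_of_ne_of_ne] <;> omega
  · rintro ⟨x, σ⟩ -
    simp

/-- The face opposite the first vertex of one simplex is the face opposite the last vertex of an
adjacent one. Faces on the boundary of the cube have no such partner inside, but their terms vanish.
-/
theorem sum_skipAt_zero_eq_last {g : (ℕ → ℤ) → ZMod 2}
    (h0 : ∀ i < n, ∀ v, v i ≤ 0 → f i v = 0) (h1 : ∀ i < n, ∀ v, (k : ℤ) ≤ v i → f i v = 1)
    (g0 : ∀ v, v n ≤ 0 → g v = 0) (g1 : ∀ v, (k : ℤ) ≤ v n → g v = 0) :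
    ∑ p ∈ (finite_kuhnSimplices (n + 1) k).toFinset,
        cupCoboundary n f (skipAt 0 (kuhnVertex p)) * g (skipAt 0 (kuhnVertex p) n) =
      ∑ p ∈ (finite_kuhnSimplices (n + 1) k).toFinset,
        cupCoboundary n f (skipAt (n + 1) (kuhnVertex p)) *
          g (skipAt (n + 1) (kuhnVertex p) n) := by
  -- The adjacent simplex starts at the second vertex and makes the first step last; `r'` is the
  -- inverse move.
  let r : (ℕ → ℤ) × Equiv.Perm ℕ → (ℕ → ℤ) × Equiv.Perm ℕ := fun p =>
    (fun l => p.1 l + if p.2 l = 0 then 1 else 0, (cyclePerm n).symm * p.2)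
  let r' : (ℕ → ℤ) × Equiv.Perm ℕ → (ℕ → ℤ) × Equiv.Perm ℕ := fun p =>
    (fun l => p.1 l - if p.2 l = n then 1 else 0, cyclePerm n * p.2)
  have hrr' : ∀ p, r (r' p) = p := by
    rintro ⟨x, σ⟩
    refine Prod.ext (funext fun l => ?_) (Equiv.ext fun l => by simp [r, r'])
    simp only [r, r', Equiv.Perm.mul_apply, cyclePerm_apply]
    grind
  have hr'r : ∀ p, r' (r p) = p := by
    rintro ⟨x, σ⟩
    refine Prod.ext (funext fun l => ?_) (Equiv.ext fun l => by simp [r, r'])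
    simp only [r, r', Equiv.Perm.mul_apply, cyclePerm_symm_apply]
    grind
  have hD : ∀ p : (ℕ → ℤ) × Equiv.Perm ℕ, (∀ l, n + 1 ≤ l → p.1 l = 0 ∧ p.2 l = l) →
      ∀ l, n + 1 ≤ l → (r p).1 l = 0 ∧ (r p).2 l = l := by
    rintro ⟨x, σ⟩ hp l hl
    have := hp l hl
    simp only [r, Equiv.Perm.mul_apply, cyclePerm_symm_apply] at this ⊢
    grind
  have hD' : ∀ p : (ℕ → ℤ) × Equiv.Perm ℕ, (∀ l, n + 1 ≤ l → p.1 l = 0 ∧ p.2 l = l) →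
      ∀ l, n + 1 ≤ l → (r' p).1 l = 0 ∧ (r' p).2 l = l := by
    rintro ⟨x, σ⟩ hp l hl
    have := hp l hl
    simp only [r', Equiv.Perm.mul_apply, cyclePerm_apply] at this ⊢
    grind
  have hv : ∀ p : (ℕ → ℤ) × Equiv.Perm ℕ, (∀ l, n + 1 ≤ l → p.1 l = 0 ∧ p.2 l = l) → ∀ i ≤ n,
      skipAt 0 (kuhnVertex p) i = skipAt (n + 1) (kuhnVertex (r p)) i := by
    rintro ⟨x, σ⟩ hp i hi
    ext l
    have := hp l
    have := perm_apply_lt (fun l hl => (hp l hl).2) (l := l)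
    simp only [skipAt_kuhnVertex_apply, r, Equiv.Perm.mul_apply, cyclePerm_symm_apply] at *
    clear hr'r hrr' hD hD' h0 h1 g0 g1
    grind
  have hh : ∀ p : (ℕ → ℤ) × Equiv.Perm ℕ, (∀ l, n + 1 ≤ l → p.1 l = 0 ∧ p.2 l = l) →
      cupCoboundary n f (skipAt 0 (kuhnVertex p)) * g (skipAt 0 (kuhnVertex p) n) =
      cupCoboundary n f (skipAt (n + 1) (kuhnVertex (r p))) *
        g (skipAt (n + 1) (kuhnVertex (r p)) n) := by
    intro p hp
    rw [cupCoboundary_congr f (hv p hp), hv p hp n le_rfl]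
  -- `r` may leave the cube, so the bijection is only between simplices with nonzero terms.
  refine Finset.sum_bij_ne_zero (fun p _ _ => r p) ?_ ?_ ?_ ?_
  · intro p hp hne
    rw [Set.Finite.mem_toFinset] at hp ⊢
    rw [hh p hp.1] at hne
    exact mem_kuhnSimplices_of_ne_zero h0 h1 g0 g1 (hD p hp.1) (skipAt_kuhnVertex _ _) hne
  · intro p _ _ q _ _ he
    rw [← hr'r p, he, hr'r]
  · intro p hp hne
    rw [Set.Finite.mem_toFinset] at hp
    have he := hh _ (hD' p hp.1)
    rw [hrr'] at he
    rw [← he] at hne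
    exact ⟨r' p, (Set.Finite.mem_toFinset _).2
      (mem_kuhnSimplices_of_ne_zero h0 h1 g0 g1 (hD' p hp.1) (skipAt_kuhnVertex _ _) hne),
      hne, hrr' p⟩
  · intro p hp _
    rw [Set.Finite.mem_toFinset] at hp
    exact hh p hp.1

/-- By the Leibniz rule each summand is the sum of a cochain over the faces of a simplex. The faces
`0` and `n + 1` cancel against each other, and each face index in between contributes zero by
itself. -/
theorem sum_cupCoboundary_mul_eq_zero {g : (ℕ → ℤ) → ZMod 2}
    (h0 : ∀ i < n, ∀ v, v i ≤ 0 → f i v = 0) (h1 : ∀ i < n, ∀ v, (k : ℤ) ≤ v i → f i v = 1)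
    (g0 : ∀ v, v n ≤ 0 → g v = 0) (g1 : ∀ v, (k : ℤ) ≤ v n → g v = 0) :
    ∑ p ∈ (finite_kuhnSimplices (n + 1) k).toFinset, cupCoboundary n f (kuhnVertex p) *
      (g (kuhnVertex p (n + 1)) + g (kuhnVertex p n)) = 0 := by
  simp_rw [← sum_cupCoboundary_mul_skipAt]
  rw [Finset.sum_comm, Finset.sum_range_succ, Finset.sum_range_succ',
    Finset.sum_eq_zero fun j hj => ?_, zero_add, sum_skipAt_zero_eq_last h0 h1 g0 g1]
  · exact CharTwo.add_self_eq_zero _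
  · exact sum_skipAt_eq_zero_of_pos (fun u => cupCoboundary n f u * g (u n)) j.succ_pos
      (Finset.mem_range.1 hj)

/-- Induction on the dimension: the last colouring may be replaced by the step function at height 1,
whose coboundary selects a copy of the Kuhn triangulation of the cube of one dimension less. -/
theorem sum_cupCoboundary_eq_one (hk : 0 < k) (n : ℕ)
    (h0 : ∀ i < n, ∀ v, v i ≤ 0 → f i v = 0) (h1 : ∀ i < n, ∀ v, (k : ℤ) ≤ v i → f i v = 1) :
    ∑ p ∈ (finite_kuhnSimplices n k).toFinset, cupCoboundary n f (kuhnVertex p) = 1 := by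
  induction n with
  | zero =>
    have : (finite_kuhnSimplices 0 k).toFinset = {(0, 1)} := by
      ext ⟨x, σ⟩
      simp only [Set.Finite.mem_toFinset, Finset.mem_singleton, Prod.mk.injEq]
      constructor
      · exact fun h => ⟨funext fun l => (h.1 l l.zero_le).1, Equiv.ext fun l => (h.1 l l.zero_le).2⟩
      · rintro ⟨rfl, rfl⟩
        exact ⟨fun l _ => ⟨rfl, rfl⟩, fun l hl => absurd hl l.not_lt_zero⟩
    rw [this, Finset.sum_singleton]
    simp [cupCoboundary]
  | succ n ih =>
    -- `f n + s` vanishes beyond both faces of the coordinate `n`, the upper one because `1 ≤ k`. So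
    -- `s` can stand in for `f n`.
    let s : (ℕ → ℤ) → ZMod 2 := fun v => if 1 ≤ v n then 1 else 0
    have hz := sum_cupCoboundary_mul_eq_zero (n := n) (g := fun v => f n v + s v)
      (fun i hi => h0 i (by omega)) (fun i hi => h1 i (by omega))
      (fun v hv => by rw [h0 n (by omega) v hv, zero_add]; exact if_neg (by omega))
      (fun v hv => by
        rw [h1 n (by omega) v hv, show s v = 1 from if_pos (by omega)]; rfl)
    rw [← ih (fun i hi => h0 i (by omega)) (fun i hi => h1 i (by omega))]
    have hs : ∑ p ∈ (finite_kuhnSimplices (n + 1) k).toFinset, cupCoboundary n f (kuhnVertex p) *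
        (s (kuhnVertex p (n + 1)) + s (kuhnVertex p n)) =
        ∑ p ∈ (finite_kuhnSimplices n k).toFinset, cupCoboundary n f (kuhnVertex p) := by
      classical
      symm
      rw [← Finset.sum_subset_zero_on_sdiff (f := fun p => cupCoboundary n f (kuhnVertex p))
        (g := fun p => cupCoboundary n f (kuhnVertex p) *
          (s (kuhnVertex p (n + 1)) + s (kuhnVertex p n)))]
      · rintro ⟨x, σ⟩ hp
        rw [Set.Finite.mem_toFinset] at hp ⊢
        refine ⟨fun l hl => hp.1 l (by omega), fun l hl => ?_⟩
        rcases Nat.lt_succ_iff_lt_or_eq.1 hl with hl | rfl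
        · exact hp.2 l hl
        · rw [(hp.1 l le_rfl).1]
          exact ⟨le_rfl, by exact_mod_cast hk⟩
      · rintro ⟨x, σ⟩ hp
        simp only [Finset.mem_sdiff, Set.Finite.mem_toFinset] at hp
        obtain ⟨hp, hp'⟩ := hp
        have hn := hp.2 n (by omega)
        have hσ := perm_apply_lt (fun l hl => (hp.1 l hl).2) (Nat.lt_succ_self n)
        -- The last edge crosses from height 0 to height 1 only if `x n = 0` and the coordinate `n`
        -- is increased last, that is `σ n = n`; these are the simplices of the lower-dimensional
        -- cube.
        have : s (kuhnVertex (x, σ) (n + 1)) = s (kuhnVertex (x, σ) n) := by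
          by_cases hx : x n = 0
          · have hσn : σ n < n := by
              by_contra hc
              refine hp' ⟨fun l hl => ?_, fun l hl => hp.2 l (by omega)⟩
              rcases hl.eq_or_lt with rfl | hl
              · exact ⟨hx, by simp only at hσ ⊢; omega⟩
              · exact hp.1 l hl
            simp only [s, kuhnVertex, if_pos hσn, if_pos (hσn.trans (Nat.lt_succ_self n))]
          · simp only at hn
            have e1 : ∀ i, 1 ≤ kuhnVertex (x, σ) i n := by
              intro i
              simp only [kuhnVertex]
              split_ifs <;> omega
            simp only [s, if_pos (e1 _)]
        rw [this, CharTwo.add_self_eq_zero, mul_zero]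
      · rintro ⟨x, σ⟩ hp
        rw [Set.Finite.mem_toFinset] at hp
        have hn := hp.1 n le_rfl
        simp only at hn
        simp [s, kuhnVertex, hn.1, hn.2]
    rw [← hs, ← sub_eq_zero (G := ZMod 2), ← Finset.sum_sub_distrib, ← hz]
    refine Finset.sum_congr rfl fun p _ => ?_
    rw [cupCoboundary_succ, CharTwo.sub_eq_add]
    ring

/-- In a fine grid on the cube, let each `f i` separate the two faces of the `i`-th coordinate.
There is a simplex of the grid on which none of the `f i` is constant. -/
theorem exists_kuhnVertex_ne (hk : 0 < k) (n : ℕ)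
    (h0 : ∀ i < n, ∀ v, v i ≤ 0 → f i v = 0) (h1 : ∀ i < n, ∀ v, (k : ℤ) ≤ v i → f i v = 1) :
    ∃ p, ∀ i < n, f i (kuhnVertex p (i + 1)) ≠ f i (kuhnVertex p i) := by
  have h : ∑ p ∈ (finite_kuhnSimplices n k).toFinset, cupCoboundary n f (kuhnVertex p) ≠ 0 := by
    rw [sum_cupCoboundary_eq_one hk n h0 h1]
    exact one_ne_zero
  obtain ⟨p, -, hp⟩ := Finset.exists_ne_zero_of_sum_ne_zero h
  refine ⟨p, fun i hi he => ?_⟩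
  refine Finset.prod_ne_zero_iff.1 hp i (Finset.mem_range.2 hi) ?_
  rw [he]
  exact CharTwo.add_self_eq_zero _

end

/-! ### Essentiality of the faces of the Hilbert cube -/

/-- The point of the Hilbert cube with coordinates `v l / k`, clamped to the unit interval. -/
noncomputable def gridPoint (k : ℕ) (v : ℕ → ℤ) : ℕ → unitInterval :=
  fun l => projIcc 0 1 zero_le_one ((v l : ℝ) / k)

theorem dist_gridPoint_le {k : ℕ} (hk : 0 < k) {v w : ℕ → ℤ} {l : ℕ} (h : |v l - w l| ≤ 1) :
    dist (gridPoint k v l) (gridPoint k w l) ≤ 1 / k := by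
  have hk' : (0 : ℝ) < k := by exact_mod_cast hk
  have h' : |(v l : ℝ) - w l| ≤ 1 := by exact_mod_cast h
  have h1 := (LipschitzWith.projIcc (zero_le_one (α := ℝ))).dist_le_mul ((v l : ℝ) / k) (w l / k)
  refine h1.trans ?_
  rw [NNReal.coe_one, one_mul, Real.dist_eq, ← sub_div, abs_div, abs_of_pos hk']
  gcongr

/-- The pairs of opposite faces of the Hilbert cube form an essential family. -/
theorem nonempty_iInter_of_isPartitionBetween_faces {L : ℕ → Set (ℕ → unitInterval)}
    (hL : ∀ i, IsPartitionBetween (L i) {t | t i = 0} {t | t i = 1}) : (⋂ i, L i).Nonempty := by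
  classical
  choose U V hU hV hAU hBV hUV hLUV using hL
  have key : ∀ N : ℕ, ∃ a : ℕ → unitInterval, ∀ i, ∃ b c : ℕ → unitInterval,
      (i ≤ N → b ∈ U i ∧ c ∉ U i) ∧ ∀ l, dist (a l) (b l) ≤ 1 / ((N : ℝ) + 1) ∧
        dist (a l) (c l) ≤ 1 / ((N : ℝ) + 1) := by
    intro N
    -- The same `N + 1` serves as number of coordinates and as fineness of the grid, so that in the
    -- limit every coordinate is covered and the mesh tends to zero.
    have hN : (0 : ℝ) < (N + 1 : ℕ) := by positivity
    obtain ⟨p, hp⟩ := exists_kuhnVertex_ne (k := N + 1)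
      (f := fun i v => if gridPoint (N + 1) v ∈ U i then 0 else 1) N.succ_pos (N + 1)
      (fun i _ v hv => by
        refine if_pos (hAU i ?_)
        refine projIcc_of_le_left _ (div_nonpos_of_nonpos_of_nonneg ?_ hN.le)
        exact_mod_cast hv)
      (fun i _ v hv => by
        refine if_neg fun h => (hUV i).le_bot ⟨h, hBV i ?_⟩
        refine projIcc_of_right_le _ ((one_le_div hN).2 ?_)
        exact_mod_cast hv)
    have hd : ∀ m l, dist (gridPoint (N + 1) (kuhnVertex p 0) l)
        (gridPoint (N + 1) (kuhnVertex p m) l) ≤ 1 / ((N : ℝ) + 1) := by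
      intro m l
      rw [← Nat.cast_succ]
      refine dist_gridPoint_le N.succ_pos ?_
      simp only [kuhnVertex]
      split_ifs <;> simp
    refine ⟨gridPoint (N + 1) (kuhnVertex p 0), fun i => ?_⟩
    by_cases hi : i ≤ N
    · have := hp i (by omega)
      by_cases h1 : gridPoint (N + 1) (kuhnVertex p (i + 1)) ∈ U i <;>
        by_cases h2 : gridPoint (N + 1) (kuhnVertex p i) ∈ U i <;> simp [h1, h2] at this
      · exact ⟨_, _, fun _ => ⟨h1, h2⟩, fun l => ⟨hd _ l, hd _ l⟩⟩
      · exact ⟨_, _, fun _ => ⟨h2, h1⟩, fun l => ⟨hd _ l, hd _ l⟩⟩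
    · exact ⟨_, _, fun h => absurd h hi, fun l => ⟨hd 0 l, hd 0 l⟩⟩
  choose a b c hbc hd using key
  obtain ⟨x, φ, hφ, hx⟩ := CompactSpace.tendsto_subseq a
  have hlim : ∀ e : ℕ → ℕ → unitInterval, (∀ N l, dist (a N l) (e N l) ≤ 1 / ((N : ℝ) + 1)) →
      Filter.Tendsto (fun j => e (φ j)) Filter.atTop (nhds x) := by
    intro e he
    rw [tendsto_pi_nhds] at hx ⊢
    intro l
    refine (hx l).congr_dist ?_
    exact squeeze_zero (fun _ => dist_nonneg) (fun j => he (φ j) l)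
      (tendsto_one_div_add_atTop_nhds_zero_nat.comp hφ.tendsto_atTop)
  refine ⟨x, mem_iInter.2 fun i => ?_⟩
  have hev : ∀ᶠ j in Filter.atTop, i ≤ φ j := hφ.tendsto_atTop.eventually_ge_atTop i
  -- The limit is approached from `U i` and from its complement. It avoids `U i`, which is open, and
  -- `V i`, which is open and disjoint from `U i`.
  have h1 : x ∈ closure (U i) := mem_closure_of_tendsto (hlim _ fun N l => (hd N i l).1)
    (hev.mono fun j hj => (hbc (φ j) i hj).1)
  have h2 : x ∈ (U i)ᶜ := (hU i).isClosed_compl.mem_of_tendsto (hlim _ fun N l => (hd N i l).2)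
    (hev.mono fun j hj => (hbc (φ j) i hj).2)
  by_contra hx
  have h3 : x ∈ U i ∪ V i := by rw [← hLUV i]; exact hx
  exact h3.elim h2 fun h => ((hUV i).closure_left (hV i)).le_bot ⟨h1, h⟩

/-! ### Box distance, couplings and finite subspaces -/

namespace MMSpace

/-- The box distance is bounded by the distortion of a coupling. -/
theorem boxDist_le_of_coupling {X Y : MMSpace} {Ω : Type*} [MeasurableSpace Ω]
    [StandardBorelSpace Ω] (P : Measure Ω) [IsProbabilityMeasure P] {a : Ω → X} {b : Ω → Y}
    (ha : Measurable a) (hb : Measurable b) (haP : P.map a = X.μ) (hbP : P.map b = Y.μ) {ε : ℝ}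
    (hε : 0 ≤ ε) (h : ∀ z w, |dist (a z) (a w) - dist (b z) (b w)| ≤ ε) : boxDist X Y ≤ ε := by
  have : Nonempty Ω := nonempty_of_isProbabilityMeasure P
  obtain ⟨θ, hθ, hθP⟩ := Measure.exists_measurable_map_eq P
  refine boxDist_le ⟨hε, a ∘ θ, b ∘ θ, ⟨ha.comp hθ, ?_⟩, ⟨hb.comp hθ, ?_⟩, univ,
    MeasurableSet.univ, fun s _ t _ => h _ _, by simpa using hε⟩
  · rw [← Measure.map_map ha hθ, hθP, haP]
  · rw [← Measure.map_map hb hθ, hθP, hbP]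

/-- If the box distance of `X` and `Y` is zero and `Y` is compact, every finite metric subspace of
the support of `X` embeds into `Y`. -/
theorem exists_dist_eq_of_boxDist_eq_zero {X Y : MMSpace} [CompactSpace Y] (h : boxDist X Y = 0)
    {ι : Type*} [Finite ι] (x : ι → X) (hx : ∀ i, x i ∈ X.μ.support) :
    ∃ y : ι → Y, ∀ i j, dist (y i) (y j) = dist (x i) (x j) := by
  have := Fintype.ofFinite ι
  have key : ∀ η : ℝ, 0 < η → ∃ y : ι → Y, ∀ i j, |dist (y i) (y j) - dist (x i) (x j)| ≤ η := by
    intro η hη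
    have hpos : ∀ i, 0 < X.μ.real (Metric.ball (x i) (η / 4)) := by
      intro i
      rw [Measure.real, ENNReal.toReal_pos_iff]
      exact ⟨(Measure.mem_support_iff_forall _).1 (hx i) _ (Metric.ball_mem_nhds _ (by positivity)),
        measure_lt_top _ _⟩
    -- A set whose complement has mass less than `ε₀` meets the preimage of every ball. Two radii `η
    -- / 4` and a distortion below `η / 2` add up to at most `η`.
    obtain ⟨ε₀, hε₀, hε₀η, hε₀x⟩ : ∃ ε₀ : ℝ, 0 < ε₀ ∧ ε₀ ≤ η / 2 ∧
        ∀ i, ε₀ ≤ X.μ.real (Metric.ball (x i) (η / 4)) := by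
      have e1 : ∀ᶠ ε in nhdsWithin (0 : ℝ) (Ioi 0),
          ∀ i, ε ≤ X.μ.real (Metric.ball (x i) (η / 4)) :=
        Filter.eventually_all.2 fun i => nhdsWithin_le_nhds (eventually_le_nhds (hpos i))
      have e2 : ∀ᶠ ε in nhdsWithin (0 : ℝ) (Ioi 0), ε ≤ η / 2 :=
        nhdsWithin_le_nhds (eventually_le_nhds (by positivity))
      obtain ⟨ε, ⟨h1, h2⟩, h3⟩ := ((e1.and e2).and self_mem_nhdsWithin).exists
      exact ⟨ε, h3, h2, h1⟩
    obtain ⟨ε, ⟨h0, φ, ψ, hφ, hψ, I, hI, hd, hm⟩, hε⟩ :=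
      exists_lt_of_csInf_lt (s := {ε : ℝ | BoxAdmissible X Y ε}) ⟨1, boxAdmissible_one X Y⟩
        (show boxDist X Y < ε₀ by rw [h]; exact hε₀)
    have hmeet : ∀ i, ∃ u ∈ I, φ u ∈ Metric.ball (x i) (η / 4) := by
      intro i
      by_contra! hc
      have hB : MeasurableSet (φ ⁻¹' Metric.ball (x i) (η / 4)) :=
        hφ.1 Metric.isOpen_ball.measurableSet
      have hdis : Disjoint I (φ ⁻¹' Metric.ball (x i) (η / 4)) :=
        disjoint_left.2 fun u hu hu' => hc u hu hu'
      have e1 := measureReal_union (μ := (volume : Measure unitInterval)) hdis hB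
      have e2 : (volume : Measure unitInterval).real
          (I ∪ φ ⁻¹' Metric.ball (x i) (η / 4)) ≤ 1 := measureReal_le_one
      have e3 : (volume : Measure unitInterval).real (φ ⁻¹' Metric.ball (x i) (η / 4)) =
          X.μ.real (Metric.ball (x i) (η / 4)) := by
        rw [← hφ.2, map_measureReal_apply hφ.1 Metric.isOpen_ball.measurableSet]
      have := hε₀x i
      linarith
    choose u huI hu using hmeet
    refine ⟨fun i => ψ (u i), fun i j => ?_⟩
    have e1 := abs_le.1 (hd _ (huI i) _ (huI j))
    have e2 := dist_dist_dist_le (φ (u i)) (φ (u j)) (x i) (x j)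
    rw [Real.dist_eq] at e2
    have e3 := abs_le.1 e2
    have e4 := Metric.mem_ball.1 (hu i)
    have e5 := Metric.mem_ball.1 (hu j)
    rw [abs_le]
    constructor <;> linarith
  -- Approximate copies with error tending to zero subconverge in the compact space to an exact
  -- copy.
  choose y hy using fun k : ℕ => key (1 / ((k : ℝ) + 1)) Nat.one_div_pos_of_nat
  obtain ⟨z, φ, hφ, hz⟩ := CompactSpace.tendsto_subseq y
  rw [tendsto_pi_nhds] at hz
  refine ⟨z, fun i j => tendsto_nhds_unique ((hz i).dist (hz j)) ?_⟩
  rw [tendsto_iff_dist_tendsto_zero]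
  exact squeeze_zero (fun _ => dist_nonneg) (fun k => hy (φ k) i j)
    (tendsto_one_div_add_atTop_nhds_zero_nat.comp hφ.tendsto_atTop)

end MMSpace

/-! ### Combs depend continuously on their parameter -/

namespace Comb

theorem dist_eq (p q : Plane) : dist p q = |p.fst - q.fst| + |p.snd - q.snd| := by
  rw [WithLp.prod_dist_eq_of_L1, Real.dist_eq, Real.dist_eq]

theorem dist_pt_pt (n : ℕ) (y z : ℝ) : dist (pt n y) (pt n z) = |y - z| := by
  rw [dist_eq]
  simp [pt]

theorem pt_mem_set {t : ℕ → unitInterval} {n : ℕ} {y : ℝ} (h : y ∈ Icc 0 (len t n)) :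
    pt n y ∈ set t :=
  Or.inr (mem_iUnion.2 ⟨n, y, h, rfl⟩)

/-- The common source of the parameters of all combs: the `n`-th copy of the real line carries the
Lebesgue measure on `[0, 2⁻⁽ⁿ⁺¹⁾]`. -/
noncomputable def source : Measure (ℕ × ℝ) :=
  Measure.sum fun n : ℕ => (volume.restrict (Icc 0 ((1 / 2) ^ (n + 1)))).map (Prod.mk n)

theorem source_apply {s : Set (ℕ × ℝ)} (hs : MeasurableSet s) :
    source s = ∑' n, volume.restrict (Icc 0 ((1 / 2) ^ (n + 1))) (Prod.mk n ⁻¹' s) := by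
  rw [source, Measure.sum_apply _ hs]
  exact tsum_congr fun n => Measure.map_apply measurable_prodMk_left hs

/-- The map of the source onto the comb that scales the `n`-th tooth by `1 + t n`. -/
noncomputable def scale (t : ℕ → unitInterval) (z : ℕ × ℝ) : set t :=
  ⟨pt z.1 (projIcc 0 ((1 / 2) ^ (z.1 + 1)) (by positivity) z.2 * (1 + t z.1)), pt_mem_set <| by
    have h1 := (projIcc (0 : ℝ) ((1 / 2) ^ (z.1 + 1)) (by positivity) z.2).2
    have h2 := (t z.1).2.1
    exact ⟨mul_nonneg h1.1 (by linarith), mul_le_mul_of_nonneg_right h1.2 (by linarith)⟩⟩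

theorem measurable_scale (t : ℕ → unitInterval) : Measurable (scale t) := by
  refine Measurable.subtype_mk (measurable_from_prod_countable_right fun n => ?_)
  refine ((continuous_pt n).comp ?_).measurable
  have hn : (0 : ℝ) ≤ (1 / 2) ^ (n + 1) := by positivity
  exact (continuous_subtype_val.comp (continuous_projIcc (h := hn))).mul
    (continuous_const (y := 1 + (t n : ℝ)))

theorem map_mul_restrict_Icc {a c : ℝ} (hc : 0 < c) :
    (volume.restrict (Icc 0 a)).map (fun y => y * c) =
      ENNReal.ofReal c⁻¹ • volume.restrict (Icc 0 (a * c)) := by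
  have hpre : (fun y => y * c) ⁻¹' Icc 0 (a * c) = Icc 0 a := by
    ext y
    simp only [mem_preimage, mem_Icc, mul_nonneg_iff_of_pos_right hc, mul_le_mul_iff_left₀ hc]
  rw [← hpre, ← Measure.restrict_map (measurable_mul_const c) measurableSet_Icc,
    Real.map_volume_mul_right hc.ne', abs_of_pos (inv_pos.2 hc), Measure.restrict_smul]

theorem map_scale_source (t : ℕ → unitInterval) : source.map (scale t) = measure t := by
  have hval : Measurable (Subtype.val : set t → Plane) := measurable_subtype_coe
  have hplane : (source.map (scale t)).map Subtype.val = planeMeasure t := by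
    ext s hs
    rw [Measure.map_apply hval hs, Measure.map_apply (measurable_scale t) (hval hs),
      source_apply (measurable_scale t (hval hs)), planeMeasure, Measure.sum_apply _ hs]
    refine tsum_congr fun n => ?_
    have hpos : (0 : ℝ) < 1 + t n := by linarith [(t n).2.1]
    rw [← Measure.map_smul, Measure.map_apply (continuous_pt n).measurable hs, len,
      ← map_mul_restrict_Icc hpos,
      Measure.map_apply (measurable_mul_const _) ((continuous_pt n).measurable hs)]
    -- The clamp `projIcc` in `scale` is invisible to the measure, which lives on the interval.
    refine measure_congr ?_
    filter_upwards [ae_restrict_mem measurableSet_Icc] with y hy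
    refine propext ?_
    change pt n (projIcc 0 ((1 / 2) ^ (n + 1)) _ y * (1 + t n)) ∈ s ↔ pt n (y * (1 + t n)) ∈ s
    rw [projIcc_of_mem _ hy]
  rw [measure, ← hplane, (MeasurableEmbedding.subtype_coe (isClosed_set t).measurableSet).comap_map]

instance : IsProbabilityMeasure source := by
  have : IsProbabilityMeasure (source.map (scale 0)) := by rw [map_scale_source]; infer_instance
  exact Measure.isProbabilityMeasure_of_map (scale 0)

theorem boxDist_space_le {t s : ℕ → unitInterval} {ε : ℝ} (hε : 0 ≤ ε)
    (h : ∀ n, (1 / 2) ^ (n + 1) * |(t n : ℝ) - s n| ≤ ε) :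
    MMSpace.boxDist (space t) (space s) ≤ 2 * ε := by
  have hd : ∀ z, dist (scale t z : Plane) (scale s z) ≤ ε := by
    intro z
    refine le_trans ?_ (h z.1)
    have h1 := (projIcc (0 : ℝ) ((1 / 2) ^ (z.1 + 1)) (by positivity) z.2).2
    change dist (pt _ _) (pt _ _) ≤ _
    rw [dist_pt_pt, ← mul_sub, abs_mul, abs_of_nonneg h1.1, add_sub_add_left_eq_sub]
    exact mul_le_mul_of_nonneg_right h1.2 (abs_nonneg _)
  refine MMSpace.boxDist_le_of_coupling (X := space t) (Y := space s) source (a := scale t)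
    (b := scale s) (measurable_scale t) (measurable_scale s) (map_scale_source t)
    (map_scale_source s) (by positivity) fun z w => ?_
  have := dist_dist_dist_le (scale t z : Plane) (scale t w) (scale s z) (scale s w)
  rw [Real.dist_eq] at this
  have h1 := hd z
  have h2 := hd w
  exact this.trans (by linarith)

theorem continuous_mk_space : Continuous fun t : ℕ → unitInterval => MMClass.mk (space t) := by
  refine continuous_iff_continuousAt.2 fun s => Metric.tendsto_nhds.2 fun ε hε => ?_
  -- Teeth from `N` on are so short that their parameters do not matter; only finitely many
  -- coordinates have to be close.
  obtain ⟨N, hN⟩ := exists_pow_lt_of_lt_one (show (0 : ℝ) < ε / 4 by positivity)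
    (by norm_num : (1 / 2 : ℝ) < 1)
  have hev : ∀ᶠ t in nhds s, ∀ n ∈ Finset.range N, dist (t n) (s n) < ε / 4 :=
    (Finset.eventually_all _).2 fun n _ =>
      (continuous_apply n).continuousAt.eventually_mem
        (Metric.ball_mem_nhds (s n) (show 0 < ε / 4 by positivity))
  filter_upwards [hev] with t ht
  rw [MMClass.dist_mk]
  refine (boxDist_space_le (ε := ε / 4) (by positivity) fun n => ?_).trans_lt (by linarith)
  have hp : (0 : ℝ) ≤ (1 / 2) ^ (n + 1) := by positivity
  by_cases hn : n < N
  · refine (mul_le_of_le_one_left (abs_nonneg _) (pow_le_one₀ (by norm_num) (by norm_num))).trans ?_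
    exact (ht n (Finset.mem_range.2 hn)).le
  · have h1 : |(t n : ℝ) - s n| ≤ 1 := by
      rw [abs_le]
      constructor <;> linarith [(t n).2.1, (t n).2.2, (s n).2.1, (s n).2.2]
    refine (mul_le_of_le_one_right hp h1).trans (le_trans ?_ hN.le)
    exact pow_le_pow_of_le_one (by norm_num) (by norm_num) (by omega)

end Comb

/-! ### The parameter is determined by the distances in the comb -/

namespace Comb

theorem len_pos (t : ℕ → unitInterval) (n : ℕ) : 0 < len t n :=
  mul_pos (by positivity) (by linarith [(t n).2.1])

theorem pow_le_len (t : ℕ → unitInterval) (n : ℕ) : (1 / 2) ^ (n + 1) ≤ len t n :=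
  le_mul_of_one_le_right (by positivity) (by linarith [(t n).2.1])

theorem len_le_pow (t : ℕ → unitInterval) (n : ℕ) : len t n ≤ (1 / 2) ^ n := by
  have h : (0 : ℝ) < (1 / 2) ^ n := by positivity
  have := (t n).2.2
  rw [len, pow_succ]
  nlinarith

theorem pt_mem_support {t : ℕ → unitInterval} {n : ℕ} {y : ℝ} (hy : y ∈ Icc 0 (len t n)) :
    (⟨pt n y, pt_mem_set hy⟩ : set t) ∈ (measure t).support := by
  rw [Measure.mem_support_iff_forall]
  intro U hU
  obtain ⟨W, hWU, hW, hyW⟩ := mem_nhds_iff.1 hU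
  obtain ⟨W', hW', rfl⟩ := isOpen_induced_iff.1 hW
  refine lt_of_lt_of_le ?_ (measure_mono hWU)
  have hO : IsOpen (pt n ⁻¹' W') := hW'.preimage (continuous_pt n)
  -- Passing to the open interval gives a nonempty open set of heights, hence positive mass, even
  -- when `y` is an endpoint.
  have hne : (pt n ⁻¹' W' ∩ Ioo 0 (len t n)).Nonempty := by
    refine mem_closure_iff.1 ?_ _ hO hyW
    rwa [closure_Ioo (len_pos t n).ne]
  have hpos : (0 : ℝ) < 1 + t n := by linarith [(t n).2.1]
  have hset := (isClosed_set t).measurableSet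
  rw [measure, comap_subtype_coe_apply hset, Subtype.image_preimage_coe, inter_comm,
    measure_inter_conull (planeMeasure_compl t)]
  refine lt_of_lt_of_le ?_ (Measure.le_sum_apply _ _ |>.trans' (ENNReal.le_tsum n))
  rw [Measure.smul_apply, Measure.map_apply (continuous_pt n).measurable hW'.measurableSet,
    Measure.restrict_apply hO.measurableSet, smul_eq_mul]
  refine ENNReal.mul_pos (ENNReal.ofReal_pos.2 (inv_pos.2 hpos)).ne' ?_
  exact (((hO.inter isOpen_Ioo).measure_pos volume hne).trans_le
    (measure_mono (inter_subset_inter_right _ Ioo_subset_Icc_self))).ne'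

theorem zero_mem_set (t : ℕ → unitInterval) : WithLp.toLp 1 (0, 0) ∈ set t := Or.inl rfl

/-- The origin is the limit of the feet of the teeth, and the support is closed. -/
theorem zero_mem_support (t : ℕ → unitInterval) :
    (⟨WithLp.toLp 1 (0, 0), zero_mem_set t⟩ : set t) ∈ (measure t).support := by
  have h0 : ∀ n, (0 : ℝ) ∈ Icc 0 (len t n) := fun n => ⟨le_rfl, len_nonneg t n⟩
  refine Measure.isClosed_support.mem_of_tendsto (b := Filter.atTop)
    (f := fun n => (⟨pt n 0, pt_mem_set (h0 n)⟩ : set t)) ?_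
    (Filter.Eventually.of_forall fun n => pt_mem_support (h0 n))
  rw [tendsto_subtype_rng]
  refine ((WithLp.prod_continuous_toLp 1 ℝ ℝ).tendsto (0, 0)).comp ?_
  refine Filter.Tendsto.prodMk_nhds ?_ tendsto_const_nhds
  simpa using (tendsto_pow_atTop_nhds_zero_of_lt_one (by norm_num : (0 : ℝ) ≤ 1 / 2)
    (by norm_num)).const_mul 2

theorem fst_pt (n : ℕ) (y : ℝ) : (pt n y).fst = 2 * (1 / 2) ^ n := rfl

theorem snd_pt (n : ℕ) (y : ℝ) : (pt n y).snd = y := rfl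

/-- These linear bounds reduce the diameter argument to `linarith`. The gap between 1 and 2 isolates
the first tooth. -/
theorem coords_of_mem {t : ℕ → unitInterval} {p : Plane} (hp : p ∈ set t) :
    0 ≤ p.fst ∧ 0 ≤ p.snd ∧ p.snd ≤ p.fst / 2 ∧ (p.fst ≤ 1 ∨ p.fst = 2 ∧ p.snd ≤ len t 0) := by
  rcases hp with rfl | hp
  · simp
  · obtain ⟨n, y, hy, rfl⟩ := mem_iUnion.1 hp
    have h1 := hy.2.trans (len_le_pow t n)
    refine ⟨by rw [fst_pt]; positivity, hy.1, by rw [fst_pt, snd_pt]; linarith, ?_⟩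
    rcases n with _ | n
    · exact Or.inr ⟨by simp [pt], hy.2⟩
    · left
      have : (1 / 2 : ℝ) ^ n ≤ 1 := pow_le_one₀ (by norm_num) (by norm_num)
      rw [fst_pt, pow_succ]
      linarith

/-- The sets of values of `p.fst + p.snd` on different teeth are disjoint. -/
theorem le_len_of_fst_add_snd_eq {t : ℕ → unitInterval} {p : Plane} (hp : p ∈ set t) {n : ℕ}
    {y : ℝ} (hy0 : 0 ≤ y) (hy : y < 2 * (1 / 2) ^ n) (h : p.fst + p.snd = 2 * (1 / 2) ^ n + y) :
    y ≤ len t n := by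
  have hn : (0 : ℝ) < (1 / 2) ^ n := by positivity
  rcases hp with rfl | hp
  · have h' : (0 : ℝ) + 0 = 2 * (1 / 2) ^ n + y := h
    linarith
  · obtain ⟨m, z, hz, rfl⟩ := mem_iUnion.1 hp
    have h1 := hz.2.trans (len_le_pow t m)
    have hz0 := hz.1
    rw [fst_pt, snd_pt] at h
    rcases lt_trichotomy m n with hmn | rfl | hmn
    · have h2 : (1 / 2 : ℝ) ^ n ≤ (1 / 2) ^ (m + 1) :=
        pow_le_pow_of_le_one (by norm_num) (by norm_num) hmn
      rw [pow_succ] at h2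
      linarith
    · have : y = z := by linarith
      rw [this]
      exact hz.2
    · have h2 : (1 / 2 : ℝ) ^ m ≤ (1 / 2) ^ (n + 1) :=
        pow_le_pow_of_le_one (by norm_num) (by norm_num) hmn
      rw [pow_succ] at h2
      linarith

/-- The diameter of the comb is attained only by the origin and the top of the first tooth. -/
theorem endpoints_of_le_dist {t : ℕ → unitInterval} {p q : Plane} (hp : p ∈ set t) (hq : q ∈ set t)
    {D : ℝ} (hD : 1 / 2 ≤ D) (h : dist p q = 2 + D) :
    D ≤ len t 0 ∧ (D = len t 0 → p = WithLp.toLp 1 (0, 0) ∨ q = WithLp.toLp 1 (0, 0)) := by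
  obtain ⟨p1, p2, p3, p4⟩ := coords_of_mem hp
  obtain ⟨q1, q2, q3, q4⟩ := coords_of_mem hq
  have hL := pow_le_len t 0
  have hL' := len_le_pow t 0
  norm_num at hL hL'
  have hz : ∀ r : Plane, r.fst = 0 → r.snd = 0 → r = WithLp.toLp 1 (0, 0) :=
    fun r h1 h2 => WithLp.ofLp_injective 1 (Prod.ext h1 h2)
  rw [dist_eq] at h
  -- Two points both on or both off the first tooth are too close. For `(2, y)` and `(a, b)` with `b
  -- ≤ a / 2`, the case `y < b` gives a distance of at most 2; otherwise `D = y - a - b`, and `D =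
  -- len t 0` forces `a = b = 0`.
  rcases p4 with p4 | ⟨p4, p5⟩ <;> rcases q4 with q4 | ⟨q4, q5⟩ <;>
    rcases abs_cases (p.fst - q.fst) with ⟨e1, f1⟩ | ⟨e1, f1⟩ <;>
    rcases abs_cases (p.snd - q.snd) with ⟨e2, f2⟩ | ⟨e2, f2⟩ <;>
    rw [e1, e2] at h <;>
    first
    | (exfalso; linarith)
    | exact ⟨by linarith, fun hD => Or.inl (hz p (by linarith) (by linarith))⟩
    | exact ⟨by linarith, fun hD => Or.inr (hz q (by linarith) (by linarith))⟩

theorem dist_zero_eq {t : ℕ → unitInterval} {p : Plane} (hp : p ∈ set t) :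
    dist (WithLp.toLp 1 (0, 0)) p = p.fst + p.snd := by
  obtain ⟨p1, p2, -⟩ := coords_of_mem hp
  rw [dist_eq]
  simp [abs_of_nonneg p1, abs_of_nonneg p2]

theorem isCompact_set (t : ℕ → unitInterval) : IsCompact (set t) := by
  have : ProperSpace Plane := FiniteDimensional.proper_real Plane
  refine Metric.isCompact_of_isClosed_isBounded (isClosed_set t) ?_
  refine (Metric.isBounded_closedBall (x := WithLp.toLp 1 (0, 0)) (r := 3)).subset fun p hp => ?_
  rw [Metric.mem_closedBall_comm, Metric.mem_closedBall, dist_zero_eq hp]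
  obtain ⟨p1, p2, p3, p4⟩ := coords_of_mem hp
  rcases p4 with p4 | ⟨p4, -⟩ <;> linarith

instance (t : ℕ → unitInterval) : CompactSpace (space t) :=
  isCompact_iff_compactSpace.1 (isCompact_set t)

/-- The value `7 / 16 = 1 / 4 + 3 / 16` lies in a gap: the tooth with foot at `1 / 4` has length at
most `1 / 8`, and the next foot is at `1 / 2`. Since the first tooth has length at least `1 / 2`,
its top does have a point at this distance, which tells the two ends of the diameter apart. -/
theorem dist_zero_ne {t : ℕ → unitInterval} {p : Plane} (hp : p ∈ set t) :
    dist (WithLp.toLp 1 (0, 0)) p ≠ 7 / 16 := by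
  rw [dist_zero_eq hp]
  intro h
  have := le_len_of_fst_add_snd_eq hp (n := 3) (y := 3 / 16) (by norm_num) (by norm_num)
    (by rw [h]; norm_num)
  have h2 := len_le_pow t 3
  norm_num at h2
  linarith

theorem dist_zero_top (t : ℕ → unitInterval) (n : ℕ) :
    dist (WithLp.toLp 1 (0, 0)) (pt n (len t n)) = 2 * (1 / 2) ^ n + len t n :=
  dist_zero_eq (pt_mem_set ⟨len_nonneg t n, le_rfl⟩)

/-- The origin, the top of the first tooth, the top of the `n`-th tooth, and the point of the first
tooth at distance `7 / 16` from its top have counterparts in a comb at box distance zero. -/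
theorem exists_points_of_boxDist_eq_zero {t s : ℕ → unitInterval}
    (h : MMSpace.boxDist (space t) (space s) = 0)
    (n : ℕ) : ∃ o ∈ set s, ∃ p ∈ set s, ∃ q ∈ set s, ∃ r ∈ set s,
      dist o p = 2 + len t 0 ∧ dist o q = 2 * (1 / 2) ^ n + len t n ∧ dist p r = 7 / 16 := by
  have hL := pow_le_len t 0
  norm_num at hL
  have h0 : ∀ n, len t n ∈ Icc 0 (len t n) := fun n => ⟨len_nonneg t n, le_rfl⟩
  have hr : len t 0 - 7 / 16 ∈ Icc 0 (len t 0) := ⟨by linarith, by linarith⟩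
  let x : Fin 4 → set t := ![⟨_, zero_mem_set t⟩, ⟨_, pt_mem_set (h0 0)⟩, ⟨_, pt_mem_set (h0 n)⟩,
    ⟨_, pt_mem_set hr⟩]
  obtain ⟨y, hy⟩ := MMSpace.exists_dist_eq_of_boxDist_eq_zero h x (by
    intro i
    fin_cases i
    exacts [zero_mem_support t, pt_mem_support (h0 0), pt_mem_support (h0 n), pt_mem_support hr])
  refine ⟨_, (y 0).2, _, (y 1).2, _, (y 2).2, _, (y 3).2, ?_, ?_, ?_⟩
  · refine (hy 0 1).trans ((dist_zero_top t 0).trans ?_)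
    norm_num
  · exact (hy 0 2).trans (dist_zero_top t n)
  · refine (hy 1 3).trans ((dist_pt_pt 0 _ _).trans ?_)
    norm_num

theorem len_zero_le_of_boxDist_eq_zero {t s : ℕ → unitInterval} (h : MMSpace.boxDist (space t) (space s) = 0) :
    len t 0 ≤ len s 0 := by
  obtain ⟨o, ho, p, hp, -, -, -, -, h1, -⟩ := exists_points_of_boxDist_eq_zero h 0
  have hL := pow_le_len t 0
  norm_num at hL
  exact (endpoints_of_le_dist ho hp hL h1).1

/-- By symmetry the diameters agree, so one of the points `o`, `p` is the origin of the second comb;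
the witness `r` rules out `p`. The distance from `o` to `q` then places `q` on the `n`-th tooth. -/
theorem len_le_of_boxDist_eq_zero {t s : ℕ → unitInterval} (h : MMSpace.boxDist (space t) (space s) = 0) (n : ℕ) :
    len t n ≤ len s n := by
  obtain ⟨o, ho, p, hp, q, hq, r, hr, h1, h2, h3⟩ := exists_points_of_boxDist_eq_zero h n
  have hL := pow_le_len t 0
  norm_num at hL
  have e : len t 0 = len s 0 :=
    le_antisymm (len_zero_le_of_boxDist_eq_zero h)
      (len_zero_le_of_boxDist_eq_zero (by rwa [MMSpace.boxDist_comm]))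
  rcases (endpoints_of_le_dist ho hp hL h1).2 e with rfl | rfl
  · rw [dist_zero_eq hq] at h2
    have hn : (0 : ℝ) < (1 / 2) ^ n := by positivity
    exact le_len_of_fst_add_snd_eq hq (len_nonneg t n) (by linarith [len_le_pow t n]) h2
  · exact absurd h3 (dist_zero_ne hr)

theorem eq_of_boxDist_eq_zero {t s : ℕ → unitInterval}
    (h : MMSpace.boxDist (space t) (space s) = 0) : t = s := by
  funext n
  have e : len t n = len s n :=
    le_antisymm (len_le_of_boxDist_eq_zero h n)
      (len_le_of_boxDist_eq_zero (by rwa [MMSpace.boxDist_comm]) n)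
  have hn : (0 : ℝ) < (1 / 2) ^ (n + 1) := by positivity
  have := mul_left_cancel₀ hn.ne' e
  exact Subtype.ext (by linarith)

end Comb

/-! ### Transfer from the Hilbert cube to the space of classes -/

theorem IsPartitionBetween.preimage {X Y : Type*} [TopologicalSpace X] [TopologicalSpace Y]
    {L A B : Set Y} (h : IsPartitionBetween L A B) {f : X → Y} (hf : Continuous f) :
    IsPartitionBetween (f ⁻¹' L) (f ⁻¹' A) (f ⁻¹' B) := by
  obtain ⟨U, V, hU, hV, hAU, hBV, hUV, hL⟩ := h
  exact ⟨f ⁻¹' U, f ⁻¹' V, hU.preimage hf, hV.preimage hf, preimage_mono hAU, preimage_mono hBV,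
    hUV.preimage f, by rw [← preimage_compl, hL, preimage_union]⟩

theorem IsPartitionBetween.mono {X : Type*} [TopologicalSpace X] {L A B A' B' : Set X}
    (h : IsPartitionBetween L A B) (hA : A' ⊆ A) (hB : B' ⊆ B) : IsPartitionBetween L A' B' := by
  obtain ⟨U, V, hU, hV, hAU, hBV, hUV, hL⟩ := h
  exact ⟨U, V, hU, hV, hA.trans hAU, hB.trans hBV, hUV, hL⟩

/-- The comb spaces form a Hilbert cube in the metric space associated with `MMClass`. -/
theorem Comb.isClosedEmbedding_separationQuotient_mk : Topology.IsClosedEmbedding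
    fun t : ℕ → unitInterval => SeparationQuotient.mk (MMClass.mk (Comb.space t)) := by
  refine (SeparationQuotient.continuous_mk.comp continuous_mk_space).isClosedEmbedding
    fun t s h => eq_of_boxDist_eq_zero ?_
  rw [← MMClass.dist_mk]
  exact Metric.inseparable_iff.1 (SeparationQuotient.mk_eq_mk.1 h)

theorem theoremB :
    Topology.IsEmbedding (fun t : ℕ → unitInterval => MMClass.mk (Comb.space t)) ∧
      StronglyInfiniteDimensional MMClass := by
  have hcl := Comb.isClosedEmbedding_separationQuotient_mk
  refine ⟨Topology.IsEmbedding.of_comp Comb.continuous_mk_space SeparationQuotient.continuous_mk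
    hcl.isEmbedding, inferInstance, ?_⟩
  -- The class space is only known to be pseudometric, so the image of a face of the cube need not
  -- be closed in it. Its image in the Hausdorff quotient is closed, and so is the preimage of that.
  let face : unitInterval → ℕ → Set MMClass := fun e i =>
    SeparationQuotient.mk ⁻¹' ((fun t : ℕ → unitInterval =>
      SeparationQuotient.mk (MMClass.mk (Comb.space t))) '' {t | t i = e})
  have hface : ∀ e i, IsClosed (face e i) := fun e i =>
    (hcl.isClosedMap _ (isClosed_eq (continuous_apply i) continuous_const)).preimage
      SeparationQuotient.continuous_mk
  refine ⟨face 0, face 1, fun i => ⟨hface 0 i, hface 1 i, ?_⟩, fun L hL => ?_⟩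
  · refine Disjoint.preimage _ ((disjoint_image_iff hcl.injective).2 (disjoint_left.2 ?_))
    intro t ht ht'
    exact zero_ne_one (α := unitInterval) (Eq.trans (Eq.symm ht) ht')
  -- The pulled-back partitions separate the opposite faces of the cube; the image of their common
  -- point lies in every `L i`.
  · obtain ⟨t, ht⟩ := nonempty_iInter_of_isPartitionBetween_faces
      (L := fun i => (fun t => MMClass.mk (Comb.space t)) ⁻¹' L i) fun i =>
      ((hL i).preimage Comb.continuous_mk_space).mono (fun t ht => ⟨t, ht, rfl⟩)
        (fun t ht => ⟨t, ht, rfl⟩)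
    exact ⟨_, mem_iInter.2 fun i => mem_iInter.1 ht i⟩
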